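/- Let $p$ be a prime, let $\mathcal V^f$ be the category of finite-dimensional $\mathbb F_p$-vector spaces and $\mathcal V$ the category of all $\mathbb F_p$-vector spaces. Let $S$ be a contravariant functor from $\mathcal V^f$ to sets; write $\alpha^*=S(\alpha)$. For $s\in S(V)$ let $\ker(s)$ be the largest subspace of $V$ of the form $\ker\alpha$, where $\alpha:V\to W$ is a linear map with $s=\alpha^*t$ for some $t\in S(W)$; call $s$ regular if $\ker(s)=0$. Assume that $S$ satisfies the weaker noetherianity condition: $\ker(\alpha^*s)=\alpha^{-1}(\ker(s))$ for all $\alpha:U\to V$ in $\mathcal V^f$ and all $s\in S(V)$. Let $\mathfrak S_S$ be the category of elements of $S$: objects are pairs $(W,\psi)$ with $W\in\mathcal V^f$ and $\psi\in S(W)$, morphisms $(W,\psi)\to(H,\eta)$ are linear maps $\gamma:W\to H$ with $\gamma^*\eta=\psi$. For $\psi\in S(W)$ and $V\in\mathcal V^f$ let $\psi\boxplus\epsilon_V\in S(W\oplus V)$ be the pullback of $\psi$ along the projection $W\oplus V\to W$. Let $\mathcal F(\mathfrak S_S,\mathcal V)$ be the category of functors $\mathfrak S_S\to\mathcal V$.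 For such a functor $F$, let $\bar\Delta F(W,\psi)$ be the kernel of the map $F(W\oplus\mathbb F_p,\psi\boxplus\epsilon_{\mathbb F_p})\to F(W,\psi)$ induced by the projection, with $\bar\Delta F(\alpha)$ induced by $\alpha\oplus\mathrm{id}$. The functor $F$ is polynomial of degree at most $n$ if $\bar\Delta^{n+1}F=0$, and polynomial if this holds for some $n\ge 0$. Let $p_n(F)$ be the greatest subfunctor of $F$ that is polynomial of degree at most $n$; $F$ is analytic if it is the colimit of $p_0(F)\subset p_1(F)\subset\cdots$. Then: 1. For every $(W,\psi)\in\mathfrak S_S$ with $\psi$ regular and every $V\in\mathcal V^f$, the functor $I_{(W\oplus V,\psi\boxplus\epsilon_V)}=\mathbb F_p^{\mathrm{Hom}_{\mathfrak S_S}(-,(W\oplus V,\psi\boxplus\epsilon_V))}$ is an injective object of $\mathcal F(\mathfrak S_S,\mathcal V)$ and is analytic. 2. The functors $I_{(W\oplus V,\psi\boxplus\epsilon_V)}$, with $\psi$ regular, form a family of cogenerators of $\mathcal F(\mathfrak S_S,\mathcal V)$. 3. Every simple object of $\mathcal F(\mathfrak S_S,\mathcal V)$ is polynomial. -/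

import Mathlib

open CategoryTheory Limits Opposite

universe u w

noncomputable section

namespace PolyElem

/-- Contravariant set-valued functors on finite dimensional `k`-vector spaces. -/
abbrev VPresheaf (k : Type) [Field k] := (FGModuleCat.{u} k)ᵒᵖ ⥤ Type w

section Kernel

variable {k : Type} [Field k] (S : VPresheaf.{u, w} k)

/-- The pullback `α^* t ∈ S(V)` of `t ∈ S(W)` along a linear map `α : V → W`. -/
def pull {V W : FGModuleCat.{u} k} (α : V →ₗ[k] W) (t : S.obj (op W)) : S.obj (op V) :=
  S.map (FGModuleCat.ofHom α).op t

theorem pull_id {V : FGModuleCat.{u} k} (t : S.obj (op V)) :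
    pull S (LinearMap.id : V →ₗ[k] V) t = t := by
  have h : (FGModuleCat.ofHom (LinearMap.id : V →ₗ[k] V)) = 𝟙 V := rfl
  unfold pull
  rw [h]
  simp

theorem pull_pull {U V W : FGModuleCat.{u} k} (α : U →ₗ[k] V) (β : V →ₗ[k] W)
    (t : S.obj (op W)) : pull S α (pull S β t) = pull S (β ∘ₗ α) t := by
  have h : (FGModuleCat.ofHom (β ∘ₗ α) : U ⟶ W) =
      FGModuleCat.ofHom α ≫ FGModuleCat.ofHom β := rfl
  unfold pull
  rw [h]
  simp

/-- The kernel of `s ∈ S(V)`: the largest subspace of `V` of the form `ker α` for a linear map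
`α : V → W` such that `s = α^* t` for some `t ∈ S(W)`. -/
def ker {V : FGModuleCat.{u} k} (s : S.obj (op V)) : Submodule k V :=
  sSup {U | ∃ (W : FGModuleCat.{u} k) (α : V →ₗ[k] W) (t : S.obj (op W)),
    s = pull S α t ∧ LinearMap.ker α = U}

theorem exists_eq_pull_mkQ {V : FGModuleCat.{u} k} {s : S.obj (op V)} {U : Submodule k V}
    (h : ∃ (W : FGModuleCat.{u} k) (α : V →ₗ[k] W) (t : S.obj (op W)),
      s = pull S α t ∧ U ≤ LinearMap.ker α) :
    ∃ t : S.obj (op (FGModuleCat.of k (V ⧸ U))),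
      s = pull S (W := FGModuleCat.of k (V ⧸ U)) U.mkQ t := by
  obtain ⟨W, α, t, hs, hU⟩ := h
  refine ⟨pull S (V := FGModuleCat.of k (V ⧸ U)) (U.liftQ α hU) t, ?_⟩
  rw [pull_pull, hs]
  congr 1

/-- The supremum defining `ker s` is attained: `s` comes from the quotient `V / ker s`. -/
theorem exists_eq_pull_mkQ_ker {V : FGModuleCat.{u} k} (s : S.obj (op V)) :
    ∃ t : S.obj (op (FGModuleCat.of k (V ⧸ ker S s))),
      s = pull S (W := FGModuleCat.of k (V ⧸ ker S s)) (ker S s).mkQ t := by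
  have key : ker S s ∈ {U | ∃ (W : FGModuleCat.{u} k) (α : V →ₗ[k] W) (t : S.obj (op W)),
      s = pull S α t ∧ LinearMap.ker α = U} := by
    have : WellFoundedGT (Submodule k V) := inferInstance
    refine (CompleteLattice.isSupClosedCompact_iff_wellFoundedGT (Submodule k V)).2 this _
      ⟨⊥, V, LinearMap.id, s, (pull_id S s).symm, LinearMap.ker_id⟩ ?_
    rintro U₁ ⟨W₁, α₁, t₁, h₁, rfl⟩ U₂ ⟨W₂, α₂, t₂, h₂, rfl⟩
    set U₁ := LinearMap.ker α₁ with hU₁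
    set U₂ := LinearMap.ker α₂ with hU₂
    obtain ⟨E, hE⟩ := exists_isCompl (U₁ ⊓ U₂)
    have hD : Disjoint (E ⊓ U₂) U₁ := by
      rw [disjoint_iff, eq_bot_iff]
      intro x hx
      have : x ∈ (U₁ ⊓ U₂) ⊓ E := ⟨⟨hx.2, hx.1.2⟩, hx.1.1⟩
      rwa [hE.inf_eq_bot] at this
    obtain ⟨C, hDC, hC⟩ := hD.exists_isCompl
    obtain ⟨C₂, hC₂'⟩ := exists_isCompl U₂
    have hC₂ := hC₂'.symm
    have aux : ∀ (W : FGModuleCat.{u} k) (α : V →ₗ[k] W) (t : S.obj (op W)) (C : Submodule k V)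
        (hC : IsCompl C (LinearMap.ker α)), s = pull S α t → pull S (C.projection _ hC) s = s := by
      intro W α t C hC hs
      rw [hs, pull_pull]
      congr 1
      ext x
      obtain ⟨c, hc, a, ha, rfl⟩ := Submodule.mem_sup.1 (hC.sup_eq_top.ge (Submodule.mem_top (x := x)))
      rw [LinearMap.comp_apply, map_add (C.projection _ hC),
        Submodule.projection_apply_of_mem_left hC hc, Submodule.projection_apply_of_mem_right hC ha,
        map_add, map_add, LinearMap.mem_ker.1 ha, map_zero]
    have e₁ := aux _ _ _ _ hC h₁
    have e₂ := aux _ _ _ _ hC₂ h₂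
    obtain ⟨t, ht⟩ := exists_eq_pull_mkQ S (s := s) (U := U₁ ⊔ U₂)
      ⟨V, C₂.projection _ hC₂ ∘ₗ C.projection _ hC, s, by rw [← pull_pull, e₂, e₁], by
        refine sup_le (fun x hx => ?_) (fun x hx => ?_)
        · rw [LinearMap.mem_ker, LinearMap.comp_apply,
            Submodule.projection_apply_of_mem_right hC hx, map_zero]
        · obtain ⟨a, ha, d, hd, rfl⟩ :=
            Submodule.mem_sup.1 (hE.sup_eq_top.ge (Submodule.mem_top (x := x)))
          have hd₂ : d ∈ U₂ := by simpa using U₂.sub_mem hx ha.2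
          rw [LinearMap.mem_ker, LinearMap.comp_apply, map_add (C.projection _ hC),
            Submodule.projection_apply_of_mem_right hC ha.1,
            Submodule.projection_apply_of_mem_left hC (hDC ⟨hd, hd₂⟩), zero_add,
            Submodule.projection_apply_of_mem_right hC₂ hd₂]⟩
    exact ⟨_, _, t, ht, Submodule.ker_mkQ _⟩
  obtain ⟨W, α, t, hs, hα⟩ := key
  exact exists_eq_pull_mkQ S ⟨W, α, t, hs, hα.ge⟩

/-- `s` is regular if its kernel is zero. -/
def IsRegular {V : FGModuleCat.{u} k} (s : S.obj (op V)) : Prop := ker S s = ⊥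

/-- The weaker noetherianity condition: `ker (α^* s) = α⁻¹ (ker s)`. -/
def WeaklyNoetherian : Prop :=
  ∀ ⦃U V : FGModuleCat.{u} k⦄ (α : U →ₗ[k] V) (s : S.obj (op V)),
    ker S (pull S α s) = (ker S s).comap α

/-- `ψ ⊞ ε_V ∈ S(W ⊕ V)`: the pullback of `ψ ∈ S(W)` along the projection `W ⊕ V → W`. -/
def box {W : FGModuleCat.{u} k} (ψ : S.obj (op W)) (V : FGModuleCat.{u} k) :
    S.obj (op (FGModuleCat.of k (W × V))) :=
  pull S (V := FGModuleCat.of k (W × V)) (LinearMap.fst k W V) ψ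


/-- For weakly noetherian `S`, `ψ ⊞ ε_V` is the only element of `S(W ⊕ V)` that restricts to `ψ` on
`W` and, on `V`, to the element induced from `S(0)` (which is `ε_V` if `S(0) = {ε}`). -/
theorem eq_box_iff (hS : WeaklyNoetherian S) {W V : FGModuleCat.{u} k} (ψ : S.obj (op W))
    (γ : S.obj (op (FGModuleCat.of k (W × V)))) :
    γ = box S ψ V ↔
      pull S (W := FGModuleCat.of k (W × V)) (LinearMap.inl k W V) γ = ψ ∧
      ∃ ε : S.obj (op (FGModuleCat.of k PUnit)),
        pull S (W := FGModuleCat.of k (W × V)) (LinearMap.inr k W V) γ =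
          pull S (W := FGModuleCat.of k PUnit) 0 ε := by
  constructor
  · rintro rfl
    refine ⟨?_, pull S (V := FGModuleCat.of k PUnit) 0 ψ, ?_⟩
    · rw [box, pull_pull]
      exact pull_id S ψ
    · rw [box, pull_pull, pull_pull]
      congr 1
  · rintro ⟨h₁, ε, h₂⟩
    have h₃ := hS (V := FGModuleCat.of k (W × V)) (LinearMap.inr k W V) γ
    have h₄ : ker S (pull S (V := V) (W := FGModuleCat.of k PUnit) 0 ε) = ⊤ :=
      top_le_iff.1 (le_sSup ⟨_, _, ε, rfl, LinearMap.ker_zero⟩)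
    rw [h₂, h₄] at h₃
    obtain ⟨t, ht⟩ := exists_eq_pull_mkQ_ker S γ
    have h₅ : γ = pull S (V := FGModuleCat.of k (W × V)) (LinearMap.inl k W V ∘ₗ
        LinearMap.fst k W V : W × V →ₗ[k] W × V) γ := by
      conv_lhs => rw [ht]
      conv_rhs => rw [ht]
      rw [pull_pull]
      congr 1
      apply LinearMap.ext
      rintro ⟨x, y⟩
      have hy : (0, y) ∈ ker S γ := (h₃.le (Submodule.mem_top (x := y)) : _)
      refine (Submodule.Quotient.eq _).2 ?_
      simpa using hy
    rw [box, ← h₁, pull_pull]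
    exact h₅

end Kernel

section Elements

variable {k : Type} [Field k]

/-- The category of elements `𝔖_S`: its objects are the pairs `(W, ψ)` with `ψ ∈ S(W)`, its
morphisms `(W, ψ) ⟶ (H, η)` the linear maps `γ : W → H` with `γ^* η = ψ`. -/
abbrev Elem (S : VPresheaf.{u, w} k) := S.Elementsᵒᵖ

variable (S : VPresheaf.{u, w} k)

/-- The object `(W, ψ)` of `𝔖_S`. -/
abbrev Elem.mk (W : FGModuleCat.{u} k) (ψ : S.obj (op W)) : Elem S :=
  op (S.elementsMk (op W) ψ)

variable {S}

/-- The vector space `W` of `(W, ψ)`. -/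
abbrev Elem.space (X : Elem S) : FGModuleCat.{u} k := X.unop.1.unop

/-- The element `ψ` of `(W, ψ)`. -/
abbrev Elem.elt (X : Elem S) : S.obj (op X.space) := X.unop.2

/-- The linear map underlying a morphism of `𝔖_S`. -/
abbrev Elem.lin {X Y : Elem S} (f : X ⟶ Y) : X.space →ₗ[k] Y.space := f.unop.val.unop.hom.hom

theorem Elem.pull_lin {X Y : Elem S} (f : X ⟶ Y) : pull S (Elem.lin f) Y.elt = X.elt :=
  f.unop.property

/-- A linear map `γ` with `γ^* η = ψ`, as a morphism `(W, ψ) ⟶ (H, η)` of `𝔖_S`. -/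
def Elem.homMk {X Y : Elem S} (γ : X.space →ₗ[k] Y.space) (h : pull S γ Y.elt = X.elt) : X ⟶ Y :=
  Quiver.Hom.op (CategoryOfElements.homMk Y.unop X.unop (FGModuleCat.ofHom γ).op h)

/-- The base field as a one-dimensional vector space in the ambient universe. -/
abbrev line (k : Type) [Field k] : FGModuleCat.{u} k := FGModuleCat.of k (ULift.{u} k)

/-- The object `(W ⊕ V, ψ ⊞ ε_V)`. -/
abbrev Elem.boxObj (X : Elem S) (V : FGModuleCat.{u} k) : Elem S :=
  Elem.mk S (FGModuleCat.of k (X.space × V)) (box S X.elt V)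

/-- The projection `(W ⊕ V, ψ ⊞ ε_V) ⟶ (W, ψ)`. -/
def Elem.proj (X : Elem S) (V : FGModuleCat.{u} k) : X.boxObj V ⟶ X :=
  Elem.homMk (LinearMap.fst k X.space V) rfl

/-- The morphism `α ⊕ id_V : (W ⊕ V, ψ ⊞ ε_V) ⟶ (H ⊕ V, η ⊞ ε_V)`. -/
def Elem.boxMap {X Y : Elem S} (α : X ⟶ Y) (V : FGModuleCat.{u} k) : X.boxObj V ⟶ Y.boxObj V :=
  Elem.homMk (LinearMap.prodMap (Elem.lin α) LinearMap.id) (by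
    change pull S _ (pull S _ _) = pull S _ _
    rw [pull_pull, ← Elem.pull_lin α, pull_pull]
    rfl)

theorem Elem.hom_ext {X Y : Elem S} {f g : X ⟶ Y} (h : Elem.lin f = Elem.lin g) : f = g :=
  Quiver.Hom.unop_inj (CategoryOfElements.ext _ _ _ (Quiver.Hom.unop_inj (FGModuleCat.hom_ext h)))

theorem Elem.boxMap_proj {X Y : Elem S} (α : X ⟶ Y) (V : FGModuleCat.{u} k) :
    Elem.boxMap α V ≫ Y.proj V = X.proj V ≫ α := Elem.hom_ext rfl

theorem Elem.boxMap_id (X : Elem S) (V : FGModuleCat.{u} k) : Elem.boxMap (𝟙 X) V = 𝟙 _ :=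
  Elem.hom_ext rfl

theorem Elem.boxMap_comp {X Y Z : Elem S} (α : X ⟶ Y) (β : Y ⟶ Z) (V : FGModuleCat.{u} k) :
    Elem.boxMap (α ≫ β) V = Elem.boxMap α V ≫ Elem.boxMap β V := Elem.hom_ext rfl

end Elements

section Polynomial

variable {k : Type} [Field k] {S : VPresheaf.{u, w} k}

/-- The category `𝓕(𝔖_S, 𝓥)` of functors from `𝔖_S` to `k`-vector spaces. -/
abbrev FunctorCat (S : VPresheaf.{u, w} k) := Elem S ⥤ ModuleCat.{u} k

/-- The difference functor: `Δ F (W, ψ)` is the kernel of the map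
`F(W ⊕ k, ψ ⊞ ε_k) → F(W, ψ)` induced by the projection, and `Δ F α` is induced by `α ⊕ id_k`. -/
def Delta (F : FunctorCat S) : FunctorCat S where
  obj X := ModuleCat.of k (LinearMap.ker (F.map (X.proj (line k))).hom)
  map {X Y} α := ModuleCat.ofHom ((F.map (Elem.boxMap α (line k))).hom.restrict (by
    intro x hx
    have h := congrArg (fun f => (F.map f).hom x) (Elem.boxMap_proj α (line k))
    simp only [F.map_comp, ModuleCat.hom_comp, LinearMap.comp_apply] at h
    rw [LinearMap.mem_ker] at hx ⊢
    rw [h, hx, map_zero]))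
  map_id X := by
    ext x
    simp [Elem.boxMap_id]
  map_comp α β := by
    ext x
    simp [Elem.boxMap_comp]

/-- The action of the difference functor on natural transformations. -/
def DeltaMap {F G : FunctorCat S} (φ : F ⟶ G) : Delta F ⟶ Delta G where
  app X := ModuleCat.ofHom ((φ.app (X.boxObj (line k))).hom.restrict (by
    intro x hx
    have h := congrArg (fun f => f.hom x) (φ.naturality (X.proj (line k)))
    simp only [ModuleCat.hom_comp, LinearMap.comp_apply] at h
    rw [LinearMap.mem_ker] at hx ⊢
    rw [← h, hx, map_zero]))
  naturality X Y α := by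
    ext x
    have h := congrArg (fun f => f.hom x.1) (φ.naturality (Elem.boxMap α (line k)))
    simp only [ModuleCat.hom_comp, LinearMap.comp_apply] at h
    exact Subtype.ext h

/-- `F` is polynomial of degree at most `n`: `Δ^{n+1} F = 0`. -/
def IsPolyOfDegreeLE (n : ℕ) (F : FunctorCat S) : Prop := IsZero (Delta^[n + 1] F)

/-- `F` is polynomial (of some degree). -/
def IsPoly (F : FunctorCat S) : Prop := ∃ n, IsPolyOfDegreeLE n F

theorem Delta_isZero {F : FunctorCat S} (hF : IsZero F) : IsZero (Delta F) := by
  rw [Functor.isZero_iff] at hF ⊢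
  intro X
  have := ModuleCat.subsingleton_of_isZero (hF (X.boxObj (line k)))
  have : Subsingleton ((Delta F).obj X) := Subtype.coe_injective.subsingleton
  exact ModuleCat.isZero_of_subsingleton _

theorem IsPolyOfDegreeLE.mono {F : FunctorCat S} {m n : ℕ} (hmn : m ≤ n)
    (h : IsPolyOfDegreeLE m F) : IsPolyOfDegreeLE n F := by
  induction n, hmn using Nat.le_induction with
  | base => exact h
  | succ n _ ih =>
    unfold IsPolyOfDegreeLE at ih ⊢
    rw [Function.iterate_succ_apply']
    exact Delta_isZero ih

/-- The inclusion `(W, ψ) ⟶ (W ⊕ V, ψ ⊞ ε_V)`, a section of the projection. -/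
def Elem.incl (X : Elem S) (V : FGModuleCat.{u} k) : X ⟶ X.boxObj V :=
  Elem.homMk (LinearMap.inl k X.space V) ((pull_pull S _ _ _).trans (pull_id S _))

theorem Elem.incl_proj (X : Elem S) (V : FGModuleCat.{u} k) : X.incl V ≫ X.proj V = 𝟙 X :=
  Elem.hom_ext rfl

theorem Delta_iSup_range {ι : Type*} {G : ι → FunctorCat S} {H : FunctorCat S}
    (φ : ∀ i, G i ⟶ H) (h : ∀ X, ⨆ i, LinearMap.range ((φ i).app X).hom = ⊤) (X : Elem S) :
    ⨆ i, LinearMap.range ((DeltaMap (φ i)).app X).hom = ⊤ := by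
  have key : ∀ K : FunctorCat S, ∀ y : K.obj (X.boxObj (line k)),
      (K.map (X.proj (line k))).hom
        (y - (K.map (X.incl (line k))).hom ((K.map (X.proj (line k))).hom y)) = 0 := by
    intro K y
    have := congrArg (fun f => (K.map f).hom ((K.map (X.proj (line k))).hom y))
      (X.incl_proj (line k))
    simp only [K.map_comp, K.map_id, ModuleCat.hom_comp, LinearMap.comp_apply,
      ModuleCat.hom_id, LinearMap.id_apply] at this
    rw [map_sub, this, sub_self]
  let r : H.obj (X.boxObj (line k)) →ₗ[k] LinearMap.ker (H.map (X.proj (line k))).hom :=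
    LinearMap.codRestrict _
      (LinearMap.id - (H.map (X.incl (line k))).hom ∘ₗ (H.map (X.proj (line k))).hom) (key H)
  have hr : ∀ x : LinearMap.ker (H.map (X.proj (line k))).hom, r x.1 = x := by
    intro x
    apply Subtype.ext
    change x.1 - (H.map (X.incl (line k))).hom ((H.map (X.proj (line k))).hom x.1) = x.1
    rw [LinearMap.mem_ker.1 x.2, map_zero, sub_zero]
  rw [eq_top_iff]
  intro x _
  have hx : r x.1 ∈ Submodule.map r (⨆ i, LinearMap.range ((φ i).app (X.boxObj (line k))).hom) := by
    rw [h]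
    exact ⟨_, Submodule.mem_top, rfl⟩
  rw [hr x, Submodule.map_iSup] at hx
  refine (iSup_mono (fun i => ?_) :
    (⨆ i, Submodule.map r (LinearMap.range ((φ i).app (X.boxObj (line k))).hom)) ≤ _) hx
  rintro _ ⟨_, ⟨y, rfl⟩, rfl⟩
  refine ⟨⟨_, key (G i) y⟩, Subtype.ext ?_⟩
  have h₁ := congrArg (fun f => f.hom y) ((φ i).naturality (X.proj (line k)))
  have h₂ := congrArg (fun f => f.hom (((G i).map (X.proj (line k))).hom y))
    ((φ i).naturality (X.incl (line k)))
  simp only [ModuleCat.hom_comp, LinearMap.comp_apply] at h₁ h₂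
  change ((φ i).app _).hom (y - _) = ((φ i).app _).hom y - _
  rw [map_sub, h₂, h₁]
  rfl

theorem Delta_iterate_isZero {ι : Type*} (m : ℕ) {G : ι → FunctorCat S} {H : FunctorCat S}
    (φ : ∀ i, G i ⟶ H) (h : ∀ X, ⨆ i, LinearMap.range ((φ i).app X).hom = ⊤)
    (hG : ∀ i, IsZero (Delta^[m] (G i))) : IsZero (Delta^[m] H) := by
  induction m generalizing G H with
  | zero =>
    rw [Functor.isZero_iff]
    intro X
    have : ∀ x : H.obj X, x = 0 := by
      intro x
      have hx : x ∈ ⨆ i, LinearMap.range ((φ i).app X).hom := by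
        rw [h]
        exact Submodule.mem_top
      rw [show (⨆ i, LinearMap.range ((φ i).app X).hom) = ⊥ from ?_] at hx
      · simpa using hx
      · rw [iSup_eq_bot]
        intro i
        have : Subsingleton ((G i).obj X) :=
          ModuleCat.subsingleton_of_isZero ((Functor.isZero_iff _).1 (hG i) X)
        rw [eq_bot_iff]
        rintro _ ⟨y, rfl⟩
        rw [Submodule.mem_bot]
        exact (congrArg _ (Subsingleton.elim (α := (G i).obj X) y 0)).trans (map_zero _)
    have : Subsingleton (H.obj X) := ⟨fun x y => (this x).trans (this y).symm⟩
    exact ModuleCat.isZero_of_subsingleton (H.obj X)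
  | succ m ih =>
    simp only [Function.iterate_succ_apply] at hG ⊢
    exact ih (fun i => DeltaMap (φ i)) (Delta_iSup_range φ h) hG

/-- A subfunctor of `F`: a family of subspaces of the `F(W, ψ)` stable under all morphisms. -/
@[ext]
structure SubFunctor (F : FunctorCat S) where
  obj : ∀ X : Elem S, Submodule k (F.obj X)
  le_comap : ∀ ⦃X Y : Elem S⦄ (f : X ⟶ Y), obj X ≤ (obj Y).comap (F.map f).hom

namespace SubFunctor

variable {F : FunctorCat S}

instance : PartialOrder (SubFunctor F) :=
  PartialOrder.lift SubFunctor.obj (fun _ _ h => SubFunctor.ext h)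

/-- A subfunctor as a functor. -/
def toFunctor (G : SubFunctor F) : FunctorCat S where
  obj X := ModuleCat.of k (G.obj X)
  map {X Y} f := ModuleCat.ofHom ((F.map f).hom.restrict (G.le_comap f))
  map_id X := by
    ext x
    simp
  map_comp f g := by
    ext x
    simp

/-- The inclusion of a subfunctor. -/
def incl (G : SubFunctor F) : G.toFunctor ⟶ F where
  app X := ModuleCat.ofHom (G.obj X).subtype
  naturality _ _ _ := rfl

/-- The inclusion between two comparable subfunctors. -/
def homOfLE {G H : SubFunctor F} (h : G ≤ H) : G.toFunctor ⟶ H.toFunctor where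
  app X := ModuleCat.ofHom (Submodule.inclusion (h X))
  naturality _ _ _ := rfl

/-- The functor from the ordered set of subfunctors of `F` to `𝓕(𝔖_S, 𝓥)`. -/
def forget (F : FunctorCat S) : SubFunctor F ⥤ FunctorCat S where
  obj G := G.toFunctor
  map h := homOfLE (leOfHom h)
  map_id _ := rfl
  map_comp _ _ := rfl

end SubFunctor

/-- `p_n(F)`, the greatest polynomial subfunctor of degree at most `n`: the sum of all polynomial
subfunctors of degree at most `n`. -/
def polyPart (F : FunctorCat S) (n : ℕ) : SubFunctor F where
  obj X := ⨆ G : {G : SubFunctor F // IsPolyOfDegreeLE n G.toFunctor}, G.1.obj X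
  le_comap X Y f := iSup_le fun G => (G.1.le_comap f).trans
    (Submodule.comap_mono (le_iSup (fun G : {G : SubFunctor F //
      IsPolyOfDegreeLE n G.toFunctor} => G.1.obj Y) G))

theorem polyPart_mono (F : FunctorCat S) : Monotone (polyPart F) := fun _ _ hmn _ =>
  iSup_le fun G => le_iSup (fun G : {G : SubFunctor F // IsPolyOfDegreeLE _ G.toFunctor} =>
    G.1.obj _) ⟨G.1, G.2.mono hmn⟩

theorem iSup_range_inclusion {M : Type*} [AddCommGroup M] [Module k M] {ι : Type*}
    (N : ι → Submodule k M) (Q : Submodule k M) (h : ∀ i, N i ≤ Q) (hQ : Q = ⨆ i, N i) :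
    ⨆ i, LinearMap.range (Submodule.inclusion (h i)) = ⊤ := by
  apply Submodule.map_injective_of_injective (f := Q.subtype) Subtype.coe_injective
  rw [Submodule.map_iSup, Submodule.map_top, Submodule.range_subtype]
  conv_rhs => rw [hQ]
  refine iSup_congr fun i => ?_
  rw [Submodule.range_inclusion, Submodule.map_comap_subtype]
  exact inf_eq_right.2 (h i)

theorem isGreatest_polyPart (F : FunctorCat S) (n : ℕ) :
    IsGreatest {G : SubFunctor F | IsPolyOfDegreeLE n G.toFunctor} (polyPart F n) := by
  have le : ∀ G : {G : SubFunctor F // IsPolyOfDegreeLE n G.toFunctor}, G.1 ≤ polyPart F n :=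
    fun G _ => le_iSup (fun G : {G : SubFunctor F // IsPolyOfDegreeLE n G.toFunctor} =>
      G.1.obj _) G
  refine ⟨?_, fun G hG => le ⟨G, hG⟩⟩
  refine Delta_iterate_isZero (n + 1) (fun G => SubFunctor.homOfLE (le G)) (fun X => ?_)
    (fun G => G.2)
  exact iSup_range_inclusion (fun G : {G : SubFunctor F // IsPolyOfDegreeLE n G.toFunctor} =>
    G.1.obj X) _ (fun G => le G X) rfl

/-- The sequence `p_0(F) ⟶ p_1(F) ⟶ p_2(F) ⟶ ⋯`. -/
def polyFiltration (F : FunctorCat S) : ℕ ⥤ FunctorCat S :=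
  (polyPart_mono F).functor ⋙ SubFunctor.forget F

/-- The inclusions `p_n(F) ⟶ F`, as a cocone over the sequence of the `p_n(F)`. -/
def polyCocone (F : FunctorCat S) : Cocone (polyFiltration F) where
  pt := F
  ι :=
    { app := fun n => (polyPart F n).incl
      naturality := fun _ _ _ => rfl }

/-- `F` is analytic if it is the colimit of the `p_n(F)`. -/
def IsAnalytic (F : FunctorCat S) : Prop := Nonempty (IsColimit (polyCocone F))

/-- The functor `I_X = k^{Hom(-, X)}`. -/
def coRep (X : Elem S) : FunctorCat S where
  obj Y := ModuleCat.of k ((Y ⟶ X) → k)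
  map f := ModuleCat.ofHom (LinearMap.funLeft k k (fun g => f ≫ g))
  map_id Y := by
    ext φ
    simp [LinearMap.funLeft_apply]
  map_comp f g := by
    ext φ
    simp [LinearMap.funLeft_apply]

/-- The family of the functors `I_{(W ⊕ V, ψ ⊞ ε_V)}` with `ψ` regular. -/
inductive IsStandardInjective (S : VPresheaf.{u, w} k) : FunctorCat S → Prop
  | intro (W : FGModuleCat.{u} k) (ψ : S.obj (op W)) (hψ : IsRegular S ψ) (V : FGModuleCat.{u} k) :
      IsStandardInjective S (coRep ((Elem.mk S W ψ).boxObj V))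

end Polynomial

end PolyElem

end

/-! By a Yoneda argument, a map `F ⟶ coRep X` is the same as a linear form on `F(X)`. Forms over a
field extend along injections, which gives injectivity, and they separate vectors. Since every
object is isomorphic to some `(W ⊕ V, ψ ⊞ ε_V)` with `ψ` regular, obtained by splitting off `ker`,
the standard functors cogenerate.

For analyticity, the group `Hom(Y, V)` acts by translation on `Hom(Y, (W ⊕ V, ψ ⊞ ε_V))`, and
functions on this set are filtered by their degree under iterated differences (`degLT`). Weak
noetherianity and regularity force any morphism out of `Y ⊞ L` to differ by a translation from one
factoring through `Y` (`exists_eq_shift`). Hence `Delta` lowers this degree by one, and each `degLT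
n` is polynomial. Over `ZMod p` the differences commute, have vanishing `p`-th power and are finite
in number for each `Y`, so every function has finite degree.

A simple functor embeds in a standard injective. One of its nonzero vectors lands in some `degLT n`,
so by simplicity the whole functor does, and it is polynomial. -/

noncomputable section

namespace PolyElem

/-! ### Maps into `coRep X`, joint injectivity, analyticity and simple functors -/

section General

variable {k : Type} [Field k] {S : VPresheaf.{u, w} k}

/-- The natural transformation `F ⟶ k^{Hom(-, X)}` attached to a linear form on `F(X)`. -/
def toCoRep (F : FunctorCat S) (X : Elem S) (l : F.obj X →ₗ[k] k) : F ⟶ coRep X where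
  app Y := ModuleCat.ofHom (LinearMap.pi fun g : Y ⟶ X => l ∘ₗ (F.map g).hom)
  naturality Y Z f := by
    ext x
    funext g
    change l ((F.map g).hom ((F.map f).hom x)) = l ((F.map (f ≫ g)).hom x)
    rw [F.map_comp]
    rfl

/-- The linear form on `F(X)` attached to a natural transformation `F ⟶ k^{Hom(-, X)}`. -/
def evalId {F : FunctorCat S} {X : Elem S} (φ : F ⟶ coRep X) : F.obj X →ₗ[k] k :=
  LinearMap.proj (R := k) (φ := fun _ : X ⟶ X => k) (𝟙 X) ∘ₗ (φ.app X).hom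

theorem toCoRep_evalId {F : FunctorCat S} {X : Elem S} (φ : F ⟶ coRep X) :
    toCoRep F X (evalId φ) = φ := by
  ext Y x
  funext g
  have h := congrArg (fun f => (f.hom x : (X ⟶ X) → k) (𝟙 X)) (φ.naturality g)
  refine h.trans ?_
  change ((φ.app Y).hom x : (Y ⟶ X) → k) (g ≫ 𝟙 X) = _
  rw [Category.comp_id]

theorem app_injective_of_mono {F G : FunctorCat S} (φ : F ⟶ G) [Mono φ] (X : Elem S) :
    Function.Injective (φ.app X).hom :=
  (ModuleCat.mono_iff_injective _).1 ((NatTrans.mono_iff_mono_app φ).1 inferInstance X)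

theorem mono_of_app_injective {F G : FunctorCat S} (φ : F ⟶ G)
    (h : ∀ X, Function.Injective (φ.app X).hom) : Mono φ :=
  (NatTrans.mono_iff_mono_app φ).2 fun X => (ModuleCat.mono_iff_injective _).2 (h X)

/-- Only the form on `A(X)` has to be extended to `B(X)`: a linear retraction at the single object
`X` suffices, with no naturality required of it. -/
theorem injective_coRep (X : Elem S) : Injective (coRep X) where
  factors {A B} g f _ := by
    obtain ⟨r, hr⟩ := (f.app X).hom.exists_leftInverse_of_injective
      (LinearMap.ker_eq_bot.2 (app_injective_of_mono f X))
    refine ⟨toCoRep B X (evalId g ∘ₗ r), ?_⟩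
    conv_rhs => rw [← toCoRep_evalId g]
    ext Y x
    funext a
    change evalId g (r ((B.map a).hom ((f.app Y).hom x))) = evalId g ((A.map a).hom x)
    have h₁ : (B.map a).hom ((f.app Y).hom x) = (f.app X).hom ((A.map a).hom x) :=
      (congrArg (fun f => f.hom x) (f.naturality a)).symm
    rw [h₁]
    exact congrArg _ (LinearMap.congr_fun hr _)

/-- `DeltaMap` restricts components to kernels, so it preserves joint injectivity. Allowing a family
of targets avoids forming their product. -/
theorem Delta_iterate_isZero_of_jointly_injective {ι : Type*} (m : ℕ) {H : FunctorCat S}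
    {G : ι → FunctorCat S} (φ : ∀ i, H ⟶ G i)
    (h : ∀ X, ∀ x : H.obj X, (∀ i, ((φ i).app X).hom x = 0) → x = 0)
    (hG : ∀ i, IsZero (Delta^[m] (G i))) : IsZero (Delta^[m] H) := by
  induction m generalizing G H with
  | zero =>
    rw [Functor.isZero_iff]
    intro X
    have hX : ∀ x : H.obj X, x = 0 := fun x => h X x fun i => by
      have : Subsingleton ((G i).obj X) :=
        ModuleCat.subsingleton_of_isZero ((Functor.isZero_iff _).1 (hG i) X)
      exact Subsingleton.elim (α := (G i).obj X) _ _
    have : Subsingleton (H.obj X) := ⟨fun x y => (hX x).trans (hX y).symm⟩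
    exact ModuleCat.isZero_of_subsingleton (H.obj X)
  | succ m ih =>
    simp only [Function.iterate_succ_apply] at hG ⊢
    exact ih (fun i => DeltaMap (φ i))
      (fun X x hx => Subtype.ext (h _ x.1 fun i => congrArg Subtype.val (hx i))) hG

/-- The `p_n(F)` form a chain, so a cocone takes the same value on `x` at every stage containing
`x`. The descended map may therefore use an arbitrary chosen stage, and additivity is checked at a
common later one. -/
theorem isAnalytic_of_forall_mem (F : FunctorCat S)
    (h : ∀ X (x : F.obj X), ∃ n, x ∈ (polyPart F n).obj X) : IsAnalytic F := by
  choose N hN using h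
  have indep : ∀ (s : Cocone (polyFiltration F)) (X : Elem S) (x : F.obj X) (m n : ℕ)
      (hm : x ∈ (polyPart F m).obj X) (hn : x ∈ (polyPart F n).obj X),
      ((s.ι.app m).app X).hom (⟨x, hm⟩ : (polyPart F m).obj X) =
        ((s.ι.app n).app X).hom (⟨x, hn⟩ : (polyPart F n).obj X) := by
    have le : ∀ (s : Cocone (polyFiltration F)) (X : Elem S) (x : F.obj X) (m n : ℕ) (_ : m ≤ n)
        (hm : x ∈ (polyPart F m).obj X) (hn : x ∈ (polyPart F n).obj X),
        ((s.ι.app m).app X).hom (⟨x, hm⟩ : (polyPart F m).obj X) =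
          ((s.ι.app n).app X).hom (⟨x, hn⟩ : (polyPart F n).obj X) := by
      intro s X x m n hmn hm hn
      rw [← s.w (homOfLE hmn)]
      rfl
    intro s X x m n hm hn
    rcases le_total m n with hmn | hmn
    · exact le s X x m n hmn hm hn
    · exact (le s X x n m hmn hn hm).symm
  refine ⟨{
    desc := fun s =>
      { app := fun X => ModuleCat.ofHom
          { toFun := fun x => ((s.ι.app (N X x)).app X).hom
              (⟨x, hN X x⟩ : (polyPart F (N X x)).obj X)
            map_add' := fun x y => ?_
            map_smul' := fun c x => ?_ }
        naturality := fun X Y f => ?_ }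
    fac := fun s n => ?_
    uniq := fun s m hm => ?_ }⟩
  · let M := max (N X x) (N X y)
    have hx := polyPart_mono F (le_max_left (N X x) (N X y)) X (hN X x)
    have hy := polyPart_mono F (le_max_right (N X x) (N X y)) X (hN X y)
    rw [indep s X x _ M _ hx, indep s X y _ M _ hy,
      indep s X (x + y) _ M _ (Submodule.add_mem _ hx hy)]
    exact map_add ((s.ι.app M).app X).hom (⟨x, hx⟩ : (polyPart F M).obj X) ⟨y, hy⟩
  · rw [indep s X (c • x) _ (N X x) _ (Submodule.smul_mem _ c (hN X x))]
    exact map_smul ((s.ι.app (N X x)).app X).hom c (⟨x, hN X x⟩ : (polyPart F (N X x)).obj X)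
  · ext x
    have hx := (polyPart F (N X x)).le_comap f (hN X x)
    refine (indep s Y ((F.map f).hom x) _ (N X x) (hN Y _) hx).trans ?_
    exact congrArg (fun f => f.hom (⟨x, hN X x⟩ : (polyPart F (N X x)).obj X))
      ((s.ι.app (N X x)).naturality f)
  · ext X x
    exact indep s X x.1 _ n _ x.2
  · ext X x
    have := congrArg (fun f => (f.app X).hom (⟨x, hN X x⟩ : (polyPart F (N X x)).obj X))
      (hm (N X x))
    exact this

/-- The preimage of a subfunctor under a natural transformation. -/
def SubFunctor.comap {F G : FunctorCat S} (φ : F ⟶ G) (Q : SubFunctor G) : SubFunctor F where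
  obj X := (Q.obj X).comap (φ.app X).hom
  le_comap X Y f x hx := by
    have h : (φ.app Y).hom ((F.map f).hom x) = (G.map f).hom ((φ.app X).hom x) :=
      congrArg (fun f => f.hom x) (φ.naturality f)
    change (φ.app Y).hom ((F.map f).hom x) ∈ Q.obj Y
    rw [h]
    exact Q.le_comap f hx

/-- The inclusion of `Q` is a nonzero monomorphism into a simple object, hence an isomorphism. -/
theorem SubFunctor.eq_top_of_simple {F : FunctorCat S} [Simple F] (Q : SubFunctor F) {X : Elem S}
    {x : F.obj X} (hx : x ∈ Q.obj X) (h₀ : x ≠ 0) (Y : Elem S) : Q.obj Y = ⊤ := by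
  have : Mono Q.incl := mono_of_app_injective _ fun _ => Subtype.coe_injective
  have hne : Q.incl ≠ 0 := fun h =>
    h₀ (congrArg (fun f => (f.app X).hom (⟨x, hx⟩ : Q.obj X)) h)
  have : IsIso Q.incl := isIso_of_mono_of_nonzero hne
  rw [eq_top_iff]
  intro y _
  have h := congrArg (fun f => (f.app Y).hom y) (IsIso.inv_hom_id Q.incl)
  have hy : (((inv Q.incl).app Y).hom y : Q.obj Y).1 = y := h
  rw [← hy]
  exact Subtype.property _

end General

/-! ### Translations, differences and the degree filtration along `V` -/

section Shift

variable {k : Type} [Field k] {S : VPresheaf.{u, w} k} {X : Elem S} {V : FGModuleCat.{u} k}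

/-- The translation action of `Hom(Y, V)` on the morphisms `Y ⟶ (W ⊕ V, ψ ⊞ ε_V)`. -/
def shift {Y : Elem S} (b : Y.space →ₗ[k] V) (g : Y ⟶ X.boxObj V) : Y ⟶ X.boxObj V :=
  -- The added term dies under the projection to `X`, along which `ψ ⊞ ε_V` is pulled back.
  Elem.homMk (Elem.lin g + LinearMap.inr k X.space V ∘ₗ b) (by
    rw [← Elem.pull_lin g]
    change pull S _ (pull S _ _) = pull S _ (pull S _ _)
    rw [pull_pull, pull_pull]
    congr 1
    ext x
    exact add_zero _)

theorem lin_shift {Y : Elem S} (b : Y.space →ₗ[k] V) (g : Y ⟶ X.boxObj V) :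
    Elem.lin (shift b g) = Elem.lin g + LinearMap.inr k X.space V ∘ₗ b := rfl

theorem shift_zero {Y : Elem S} (g : Y ⟶ X.boxObj V) : shift 0 g = g := by
  apply Elem.hom_ext
  rw [lin_shift, LinearMap.comp_zero]
  exact add_zero _

theorem shift_shift {Y : Elem S} (b c : Y.space →ₗ[k] V) (g : Y ⟶ X.boxObj V) :
    shift b (shift c g) = shift (b + c) g := by
  apply Elem.hom_ext
  simp only [lin_shift]
  rw [LinearMap.comp_add, add_assoc, add_comm (LinearMap.comp _ c)]

theorem comp_shift {Y Z : Elem S} (f : Y ⟶ Z) (b : Z.space →ₗ[k] V) (g : Z ⟶ X.boxObj V) :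
    f ≫ shift b g = shift (b ∘ₗ Elem.lin f) (f ≫ g) :=
  Elem.hom_ext rfl

variable (X V) in
/-- Translation of functions on `Hom(Y, (W ⊕ V, ψ ⊞ ε_V))`. -/
def shiftFun {Y : Elem S} (b : Y.space →ₗ[k] V) : Module.End k ((Y ⟶ X.boxObj V) → k) :=
  LinearMap.funLeft k k (shift b)

variable (X V) in
/-- The difference operator on functions on `Hom(Y, (W ⊕ V, ψ ⊞ ε_V))` in a direction of
`Hom(Y, V)`. -/
def diff {Y : Elem S} (b : Y.space →ₗ[k] V) : Module.End k ((Y ⟶ X.boxObj V) → k) :=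
  shiftFun X V b - 1

theorem shiftFun_pow_apply {Y : Elem S} (b : Y.space →ₗ[k] V) (n : ℕ) (f : (Y ⟶ X.boxObj V) → k)
    (g : Y ⟶ X.boxObj V) : (shiftFun X V b ^ n) f g = f (shift (n • b) g) := by
  induction n generalizing g with
  | zero => rw [zero_smul, shift_zero]; rfl
  | succ n ih =>
    rw [pow_succ']
    change (shiftFun X V b ^ n) f (shift b g) = _
    rw [ih, shift_shift, succ_nsmul]

theorem commute_diff {Y : Elem S} (b c : Y.space →ₗ[k] V) :
    Commute (diff X V b) (diff X V c) := by
  have h : Commute (shiftFun X V b) (shiftFun X V c) := by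
    apply LinearMap.ext
    intro f
    funext g
    change f (shift c (shift b g)) = f (shift b (shift c g))
    rw [shift_shift, shift_shift, add_comm]
  exact (h.sub_left (Commute.one_left _)).sub_right
    ((Commute.one_right _).sub_left (Commute.one_left _))

/-- With `T` the translation by `b`, `(T - 1)^p = T^p - 1` in characteristic `p`, and `T^p` is
translation by `p • b = 0`. -/
theorem diff_pow_char (p : ℕ) [Fact p.Prime] [CharP k p] {Y : Elem S} (b : Y.space →ₗ[k] V) :
    diff X V b ^ p = 0 := by
  -- The identity is proved in the commutative ring `k[X]` and then evaluated at `T`.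
  have h := congrArg (Polynomial.aeval (shiftFun X V b))
    (sub_pow_char (R := Polynomial k) (p := p) Polynomial.X 1)
  rw [one_pow, map_pow, map_sub, map_sub, map_pow, Polynomial.aeval_X, map_one] at h
  change diff X V b ^ p = _ at h
  rw [h, sub_eq_zero]
  apply LinearMap.ext
  intro f
  funext g
  rw [shiftFun_pow_apply, ← Nat.cast_smul_eq_nsmul k, CharP.cast_eq_zero, zero_smul, shift_zero]
  rfl

variable (X V) in
/-- The functions on `Hom(Y, (W ⊕ V, ψ ⊞ ε_V))` that are killed by all `n`-fold differences. -/
def degLTObj : ℕ → ∀ Y : Elem S, Submodule k ((Y ⟶ X.boxObj V) → k)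
  | 0, _ => ⊥
  | n + 1, Y => ⨅ b : Y.space →ₗ[k] V, (degLTObj n Y).comap (diff X V b)

theorem mem_degLTObj_succ {n : ℕ} {Y : Elem S} {f : (Y ⟶ X.boxObj V) → k} :
    f ∈ degLTObj X V (n + 1) Y ↔ ∀ b, diff X V b f ∈ degLTObj X V n Y := by
  simp [degLTObj]

/-- Precomposition with `a` turns the difference along `b` into the difference along `b ∘ a`, by
`comp_shift`. -/
theorem funLeft_mem_degLTObj {n : ℕ} {Y Z : Elem S} (a : Y ⟶ Z) {f : (Y ⟶ X.boxObj V) → k}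
    (hf : f ∈ degLTObj X V n Y) :
    LinearMap.funLeft k k (fun g : Z ⟶ X.boxObj V => a ≫ g) f ∈ degLTObj X V n Z := by
  induction n generalizing f with
  | zero =>
    obtain rfl : f = 0 := hf
    exact Submodule.zero_mem _
  | succ n ih =>
    rw [mem_degLTObj_succ] at hf ⊢
    intro b
    have h := ih (hf (b ∘ₗ Elem.lin a))
    convert h using 1
    funext g
    change f (a ≫ shift b g) - f (a ≫ g) = f (shift _ (a ≫ g)) - f (a ≫ g)
    rw [comp_shift]

variable (X V) in
/-- The subfunctor of `I_{(W ⊕ V, ψ ⊞ ε_V)}` of functions of degree less than `n` along `V`. -/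
def degLT (n : ℕ) : SubFunctor (coRep (X.boxObj V)) where
  obj Y := degLTObj X V n Y
  le_comap _ _ a _ hf := funLeft_mem_degLTObj a hf

/-- The claim is that the `X`-component of `g` vanishes on `L`. As `X.elt` is regular, the kernel of
this component is the kernel of the element of `Y ⊞ L`, which contains `L` because that element is
pulled back from `Y`. What remains of `g` on `L` is a linear map to `V`. -/
theorem exists_eq_shift (hS : WeaklyNoetherian S) (hX : IsRegular S X.elt) {Y : Elem S}
    {L : FGModuleCat.{u} k} (g : Y.boxObj L ⟶ X.boxObj V) :
    ∃ (g₀ : Y ⟶ X.boxObj V) (b : L →ₗ[k] V),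
      g = shift (b ∘ₗ LinearMap.snd k Y.space L) (Y.proj L ≫ g₀) := by
  refine ⟨Y.incl L ≫ g,
    LinearMap.snd k X.space V ∘ₗ Elem.lin g ∘ₗ LinearMap.inr k Y.space L, Elem.hom_ext ?_⟩
  have h : ∀ y : L, (Elem.lin g (0, y)).1 = 0 := by
    intro y
    have h₁ : pull S (Elem.lin (g ≫ X.proj V)) X.elt = pull S (Elem.lin (Y.proj L)) Y.elt :=
      Elem.pull_lin (g ≫ X.proj V)
    have h₂ := hS (Elem.lin (g ≫ X.proj V)) X.elt
    rw [h₁, hS, hX] at h₂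
    have h₃ : ((0, y) : Y.space × L) ∈ (ker S Y.elt).comap (Elem.lin (Y.proj L)) :=
      Submodule.zero_mem (ker S Y.elt)
    rw [h₂] at h₃
    exact h₃
  apply LinearMap.ext
  rintro ⟨x, y⟩
  have e : ((x, y) : Y.space × L) = (x, 0) + (0, y) := by simp
  refine (congrArg (Elem.lin g) e).trans ((map_add (Elem.lin g) _ _).trans ?_)
  refine congrArg (Elem.lin g (x, 0) + ·) ?_
  exact Prod.ext (h y) rfl

variable (X V) in
/-- The map from the difference functor of functions of degree less than `n + 1` to functions of
degree less than `n` given by evaluation on a slice. -/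
def slice (n : ℕ) (b : line k →ₗ[k] V) :
    Delta (degLT X V (n + 1)).toFunctor ⟶ (degLT X V n).toFunctor where
  app Y := ModuleCat.ofHom (LinearMap.codRestrict (degLTObj X V n Y)
    (LinearMap.funLeft k k (fun g : Y ⟶ X.boxObj V => Y.proj (line k) ≫ g) ∘ₗ
      diff X V (b ∘ₗ LinearMap.snd k Y.space (line k)) ∘ₗ
      ((degLT X V (n + 1)).incl.app (Y.boxObj (line k))).hom ∘ₗ
      (LinearMap.ker ((degLT X V (n + 1)).toFunctor.map (Y.proj (line k))).hom).subtype)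
    (fun f => funLeft_mem_degLTObj _ (mem_degLTObj_succ.1 f.1.2 _)))
  naturality Y Z a := by
    ext f
    refine Subtype.ext ?_
    funext g
    change f.1.1 (Elem.boxMap a (line k) ≫ shift _ (Z.proj (line k) ≫ g)) -
      f.1.1 (Elem.boxMap a (line k) ≫ Z.proj (line k) ≫ g) =
      f.1.1 (shift _ (Y.proj (line k) ≫ a ≫ g)) - f.1.1 (Y.proj (line k) ≫ a ≫ g)
    rfl

/-- An element of `Delta` vanishes on morphisms factoring through the projection. Every other
morphism is a translate of one of these, so its value is a difference recorded by some `slice`. -/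
theorem slice_jointly_injective (hS : WeaklyNoetherian S) (hX : IsRegular S X.elt) (n : ℕ)
    (Y : Elem S) (f : (Delta (degLT X V (n + 1)).toFunctor).obj Y)
    (h : ∀ b, ((slice X V n b).app Y).hom f = 0) : f = 0 := by
  refine Subtype.ext (Subtype.ext ?_)
  funext g
  obtain ⟨g₀, b, rfl⟩ := exists_eq_shift hS hX g
  have h₀ : ((degLT X V (n + 1)).toFunctor.map (Y.proj (line k))).hom f.1 = 0 := f.2
  have h₁ : f.1.1 (Y.proj (line k) ≫ g₀) = 0 := congrFun (congrArg Subtype.val h₀) g₀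
  have h₂ : f.1.1 (shift (b ∘ₗ LinearMap.snd k Y.space (line k)) (Y.proj (line k) ≫ g₀)) -
      f.1.1 (Y.proj (line k) ≫ g₀) = 0 :=
    congrFun (congrArg Subtype.val (h b)) g₀
  rw [h₁, sub_zero] at h₂
  exact h₂

theorem Delta_iterate_degLT_isZero (hS : WeaklyNoetherian S) (hX : IsRegular S X.elt) (n : ℕ) :
    IsZero (Delta^[n] (degLT X V n).toFunctor) := by
  induction n with
  | zero =>
    refine (Functor.isZero_iff _).2 fun Y => ?_
    have : Subsingleton ((Delta^[0] (degLT X V 0).toFunctor).obj Y) :=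
      inferInstanceAs (Subsingleton (⊥ : Submodule k ((Y ⟶ X.boxObj V) → k)))
    exact ModuleCat.isZero_of_subsingleton _
  | succ n ih =>
    rw [Function.iterate_succ_apply]
    exact Delta_iterate_isZero_of_jointly_injective n (slice X V n)
      (slice_jointly_injective hS hX n) fun _ => ih

/-- The bound is one more than necessary for positive `n`; this treats `n = 0` uniformly. -/
theorem isPolyOfDegreeLE_degLT (hS : WeaklyNoetherian S) (hX : IsRegular S X.elt) (n : ℕ) :
    IsPolyOfDegreeLE n (degLT X V n).toFunctor := by
  unfold IsPolyOfDegreeLE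
  rw [Function.iterate_succ_apply']
  exact Delta_isZero (Delta_iterate_degLT_isZero hS hX n)

/-- The exponents `c` are a budget of differences. One along `b` lowers `c b` by one and, by
commutation, preserves the other annihilation conditions; if `c b` is already `0`, then `f = 0`. -/
theorem mem_degLTObj_of_diff_pow {Y : Elem S} [Fintype (Y.space →ₗ[k] V)]
    (n : ℕ) (c : (Y.space →ₗ[k] V) → ℕ) (hc : ∑ b, c b = n) (f : (Y ⟶ X.boxObj V) → k)
    (hf : ∀ b, (diff X V b ^ c b) f = 0) : f ∈ degLTObj X V n Y := by
  classical
  induction n generalizing c f with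
  | zero =>
    have h₀ := hf 0
    rw [(Finset.sum_eq_zero_iff.1 hc) 0 (Finset.mem_univ _)] at h₀
    exact h₀
  | succ n ih =>
    rw [mem_degLTObj_succ]
    intro b
    rcases Nat.eq_zero_or_pos (c b) with hb | hb
    · have h₀ := hf b
      rw [hb] at h₀
      obtain rfl : f = 0 := h₀
      rw [map_zero]
      exact Submodule.zero_mem _
    · refine ih (Function.update c b (c b - 1)) ?_ _ fun b' => ?_
      · have h₁ := Finset.sum_update_of_mem (Finset.mem_univ b) c (c b - 1)
        have h₂ := Finset.add_sum_erase Finset.univ c (Finset.mem_univ b)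
        rw [← Finset.erase_eq] at h₁
        omega
      · by_cases h : b' = b
        · subst h
          rw [Function.update_self, ← Module.End.mul_apply, ← pow_succ, Nat.sub_add_cancel hb]
          exact hf b'
        · rw [Function.update_of_ne h, ← Module.End.mul_apply,
            ((commute_diff b' b).pow_left (c b')).eq, Module.End.mul_apply, hf, map_zero]

end Shift

/-! ### Splitting off the kernel, and detection of vectors -/

section Standard

variable {k : Type} [Field k] {S : VPresheaf.{u, w} k}

/-- Every object of `𝔖_S` is isomorphic to some `(W ⊕ V, ψ ⊞ ε_V)` with `ψ` regular. -/
theorem exists_iso_boxObj (hS : WeaklyNoetherian S) (X : Elem S) :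
    ∃ (W : FGModuleCat.{u} k) (ψ : S.obj (op W)) (V : FGModuleCat.{u} k),
      IsRegular S ψ ∧ Nonempty (X ≅ (Elem.mk S W ψ).boxObj V) := by
  obtain ⟨ψ, hψ⟩ := exists_eq_pull_mkQ_ker S X.elt
  obtain ⟨E, hE⟩ := exists_isCompl (ker S X.elt)
  let U := ker S X.elt
  let V : FGModuleCat.{u} k := FGModuleCat.of k U
  let r : X.space →ₗ[k] U := U.projectionOnto E hE
  refine ⟨_, ψ, V, ?_, ?_⟩
  -- Here `U` is the preimage of `ker ψ` under the surjection `mkQ`, so `ker ψ` is the image of `U`,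
  -- which is zero.
  · have h := hS (U := X.space) (V := FGModuleCat.of k (X.space ⧸ U)) U.mkQ ψ
    rw [← hψ] at h
    have h' := congrArg (Submodule.map U.mkQ) h
    rw [Submodule.map_comap_eq_of_surjective U.mkQ_surjective] at h'
    exact h'.symm.trans (Submodule.mkQ_map_self U)
  · have hbij : Function.Bijective (U.mkQ.prod r) := by
      constructor
      · rw [injective_iff_map_eq_zero]
        intro x hx
        have hxU : x ∈ U := (Submodule.Quotient.mk_eq_zero U).1 (congrArg Prod.fst hx)
        have hr : r x = 0 := congrArg Prod.snd hx
        rw [Submodule.projectionOnto_apply_of_mem_left hE hxU] at hr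
        exact congrArg Subtype.val hr
      · rintro ⟨y, v⟩
        obtain ⟨x, rfl⟩ := U.mkQ_surjective y
        refine ⟨x - r x + v, Prod.ext ?_ ?_⟩
        · exact (Submodule.Quotient.eq U).2 (by
            rw [show x - (r x : X.space) + v - x = v - r x by abel]
            exact U.sub_mem v.2 (r x).2)
        · change r (x - r x + v) = v
          rw [map_add, map_sub, Submodule.projectionOnto_apply_left hE,
            Submodule.projectionOnto_apply_left hE, sub_self, zero_add]
    let e := LinearEquiv.ofBijective (U.mkQ.prod r) hbij
    have he : pull S (W := FGModuleCat.of k ((X.space ⧸ U) × U)) e.toLinearMap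
        (box S (W := FGModuleCat.of k (X.space ⧸ U)) ψ V) = X.elt := by
      rw [box, pull_pull]
      exact hψ.symm
    have he' : pull S (V := FGModuleCat.of k ((X.space ⧸ U) × U)) e.symm.toLinearMap X.elt =
        box S (W := FGModuleCat.of k (X.space ⧸ U)) ψ V := by
      rw [← he, pull_pull]
      have : e.toLinearMap ∘ₗ e.symm.toLinearMap = LinearMap.id := e.comp_symm
      rw [this]
      exact pull_id S (V := FGModuleCat.of k ((X.space ⧸ U) × U)) _
    exact ⟨{
      hom := Elem.homMk e.toLinearMap he
      inv := Elem.homMk e.symm.toLinearMap he'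
      hom_inv_id := Elem.hom_ext e.symm_comp
      inv_hom_id := Elem.hom_ext e.comp_symm }⟩

/-- Any nonzero vector of a functor is detected by a map to a standard injective. -/
theorem exists_hom_app_ne_zero (hS : WeaklyNoetherian S) {F : FunctorCat S} {Y : Elem S}
    {x : F.obj Y} (hx : x ≠ 0) :
    ∃ (W : FGModuleCat.{u} k) (ψ : S.obj (op W)) (V : FGModuleCat.{u} k),
      IsRegular S ψ ∧ ∃ φ : F ⟶ coRep ((Elem.mk S W ψ).boxObj V), (φ.app Y).hom x ≠ 0 := by
  obtain ⟨W, ψ, V, hψ, ⟨e⟩⟩ := exists_iso_boxObj hS Y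
  have he : (F.map e.hom).hom x ≠ 0 := fun h => hx (by
    have h₁ := congrArg (fun f => f.hom x) (F.mapIso e).hom_inv_id
    exact h₁.symm.trans ((congrArg (F.map e.inv).hom h).trans (map_zero _)))
  obtain ⟨l, hl⟩ := Module.Projective.exists_dual_ne_zero k he
  -- The image of `x` is a function on morphisms; its value at `e.hom` is `l` of the transported
  -- vector.
  refine ⟨W, ψ, V, hψ, toCoRep F _ l, fun h => hl (congrFun h e.hom)⟩

end Standard

/-! ### The prime field: analyticity, simple functors, cogenerators -/

section Prime

variable {p : ℕ} [Fact p.Prime] {S : VPresheaf.{u, w} (ZMod p)}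

/-- `Hom(Y, V)` is finite and each difference has zero `p`-th power, so `n = p * |Hom(Y, V)|` works.
-/
theorem exists_mem_degLT {X : Elem S} {V : FGModuleCat.{u} (ZMod p)} {Y : Elem S}
    (f : (Y ⟶ X.boxObj V) → ZMod p) : ∃ n, f ∈ (degLT X V n).obj Y := by
  have : Finite (Y.space →ₗ[ZMod p] V) := Module.finite_of_finite (ZMod p)
  have := Fintype.ofFinite (Y.space →ₗ[ZMod p] V)
  refine ⟨_, mem_degLTObj_of_diff_pow _ (fun _ => p) rfl f fun b => ?_⟩
  rw [diff_pow_char p]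
  rfl

theorem isAnalytic_coRep_boxObj (hS : WeaklyNoetherian S) {X : Elem S} (hX : IsRegular S X.elt)
    (V : FGModuleCat.{u} (ZMod p)) : IsAnalytic (coRep (X.boxObj V)) :=
  isAnalytic_of_forall_mem _ fun Y f =>
    (exists_mem_degLT (Y := Y) f).imp fun n hn =>
      (isGreatest_polyPart _ n).2 (isPolyOfDegreeLE_degLT hS hX n) Y hn

theorem isPoly_of_simple (hS : WeaklyNoetherian S) (F : FunctorCat S) [Simple F] : IsPoly F := by
  have hF : ∃ Y, ∃ x : F.obj Y, x ≠ 0 := by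
    by_contra! h
    refine Simple.not_isZero F ((Functor.isZero_iff _).2 fun Y => ?_)
    have : Subsingleton (F.obj Y) := ⟨fun x y => (h Y x).trans (h Y y).symm⟩
    exact ModuleCat.isZero_of_subsingleton (F.obj Y)
  obtain ⟨Y, x, hx⟩ := hF
  obtain ⟨W, ψ, V, hψ, φ, hφ⟩ := exists_hom_app_ne_zero hS hx
  obtain ⟨n, hn⟩ := exists_mem_degLT (Y := Y) ((φ.app Y).hom x)
  -- The preimage of `degLT n` contains `x ≠ 0`, so it is all of `F`, and the monomorphism `φ` lands
  -- in a polynomial functor.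
  have htop := ((degLT _ V n).comap φ).eq_top_of_simple (x := x) hn hx
  have : Mono φ := mono_of_nonzero_from_simple fun h => hφ (by rw [h]; rfl)
  let φ' : F ⟶ (degLT (Elem.mk S W ψ) V n).toFunctor :=
    { app := fun Z => ModuleCat.ofHom (LinearMap.codRestrict _ (φ.app Z).hom fun z =>
        (htop Z).ge (Submodule.mem_top (x := z)))
      naturality := fun Z Z' a => by
        ext z
        exact Subtype.ext (congrArg (fun f => f.hom z) (φ.naturality a)) }
  refine ⟨n, Delta_iterate_isZero_of_jointly_injective (n + 1) (fun _ : Unit => φ')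
    (fun Z z hz => app_injective_of_mono φ Z ?_) fun _ => isPolyOfDegreeLE_degLT hS hψ n⟩
  rw [map_zero]
  exact congrArg Subtype.val (hz ())

theorem isCoseparating_isStandardInjective (hS : WeaklyNoetherian S) :
    ObjectProperty.IsCoseparating (IsStandardInjective S) := by
  intro A B f g h
  ext Y x
  by_contra hne
  obtain ⟨W, ψ, V, hψ, φ, hφ⟩ := exists_hom_app_ne_zero hS (sub_ne_zero.2 hne)
  apply hφ
  rw [map_sub, sub_eq_zero]
  exact congrArg (fun f => (f.app Y).hom x) (h _ ⟨W, ψ, hψ, V⟩ φ)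

end Prime

end PolyElem

end

theorem mainTheorem5 (p : ℕ) [Fact p.Prime] (S : PolyElem.VPresheaf.{u, w} (ZMod p))
    (hS : PolyElem.WeaklyNoetherian S) :
    (∀ (W : FGModuleCat.{u} (ZMod p)) (ψ : S.obj (op W)), PolyElem.IsRegular S ψ →
      ∀ V : FGModuleCat.{u} (ZMod p),
        Injective (PolyElem.coRep ((PolyElem.Elem.mk S W ψ).boxObj V)) ∧
        PolyElem.IsAnalytic (PolyElem.coRep ((PolyElem.Elem.mk S W ψ).boxObj V))) ∧
    ObjectProperty.IsCoseparating (PolyElem.IsStandardInjective S) ∧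
    (∀ F : PolyElem.FunctorCat S, Simple F → PolyElem.IsPoly F) :=
  ⟨fun _ _ hψ V => ⟨PolyElem.injective_coRep _, PolyElem.isAnalytic_coRep_boxObj hS hψ V⟩,
    PolyElem.isCoseparating_isStandardInjective hS, fun F _ => PolyElem.isPoly_of_simple hS F⟩
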